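/- Let $\Psi\colon[0,\infty)\to[0,\infty)$ be an Orlicz function, i.e. a convex non-decreasing function with $\Psi(0)=0$ and $\Psi(x)\to\infty$ as $x\to\infty$. For a finite measure space $(S,\mu)$, let $L^\Psi(\mu)$ be the set of classes of measurable $f\colon S\to\mathbb C$ with $\int_S\Psi(|f|/C)\,d\mu<\infty$ for some $C>0$, let $\|f\|_\Psi$ be the infimum of all $C>0$ with $\int_S\Psi(|f|/C)\,d\mu\le 1$, and let $L^{\Psi,\infty}(\mu)$ be the set of classes of measurable $f\colon S\to\mathbb C$ for which there is $c>0$ such that $\mu(|f|>t)\le 1/\Psi(ct)$ for every $t>0$ (with $1/0=\infty$). Let $\mathcal A$ be the normalized area measure on the open unit disk $\mathbb D\subset\mathbb C$ and $m$ the normalized Lebesgue measure on the unit circle. Let $H^\Psi$ be the space of those $f$ in the Hardy space $H^1$ of $\mathbb D$ whose boundary values function $f^*(\xi)=\lim_{r\to1^-}f(r\xi)$ (which exists for $m$-almost every $\xi$) belongs to $L^\Psi(m)$, with norm $\|f\|_{H^\Psi}=\|f^*\|_\Psi$, and let $J_\Psi$ be the canonical injection $f\mapsto f$ of $H^\Psi$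 into the Bergman-Orlicz space of analytic functions in $L^\Psi(\mathbb D,\mathcal A)$. Call $J_\Psi$ order bounded into $L^\Psi(\mathbb D,\mathcal A)$ if there is a non-negative $y\in L^\Psi(\mathbb D,\mathcal A)$ such that $|f|\le y$ $\mathcal A$-almost everywhere on $\mathbb D$ for every $f\in H^\Psi$ with $\|f\|_{H^\Psi}\le 1$. Then $J_\Psi$ is order bounded into $L^\Psi(\mathbb D,\mathcal A)$ if and only if $L^\Psi(\mathbb D,\mathcal A)=L^{\Psi,\infty}(\mathbb D,\mathcal A)$. Moreover, if $\Psi$ satisfies the condition $\Delta^1$, i.e. there is $\alpha>1$ with $x\Psi(x)\le\Psi(\alpha x)$ for all sufficiently large $x$, then both of these properties hold. -/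

import Mathlib

open MeasureTheory Filter Topology Set

noncomputable section

/-- An Orlicz function `Ψ : [0, ∞) → [0, ∞)`: convex, non-decreasing, `Ψ 0 = 0`, `Ψ(∞) = ∞`.
It is represented by a function on `ℝ` of which only the values on `[0, ∞)` matter
(these values are nonnegative by monotonicity and `Ψ 0 = 0`). -/
structure IsOrliczFunction (Ψ : ℝ → ℝ) : Prop where
  convexOn : ConvexOn ℝ (Ici 0) Ψ
  monotoneOn : MonotoneOn Ψ (Ici 0)
  map_zero : Ψ 0 = 0
  tendsto_atTop : Tendsto Ψ atTop atTop

/-- The growth condition `Δ¹`: there is `α > 1` with `x Ψ(x) ≤ Ψ(α x)` for all large `x`. -/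
def DeltaOne (Ψ : ℝ → ℝ) : Prop :=
  ∃ α : ℝ, 1 < α ∧ ∀ᶠ x : ℝ in atTop, x * Ψ x ≤ Ψ (α * x)

section Spaces

variable {S : Type*} [MeasurableSpace S]

/-- The modular `∫ Ψ(|f| / C) dμ`, with values in `[0, ∞]`. -/
def orliczModular (Ψ : ℝ → ℝ) (μ : Measure S) (f : S → ℂ) (C : ℝ) : ENNReal :=
  ∫⁻ s, ENNReal.ofReal (Ψ (‖f s‖ / C)) ∂μ

/-- `f` is measurable and `∫ Ψ(|f| / C) dμ < ∞` for some `C > 0`. -/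
def MemOrlicz (Ψ : ℝ → ℝ) (μ : Measure S) (f : S → ℂ) : Prop :=
  AEStronglyMeasurable f μ ∧ ∃ C : ℝ, 0 < C ∧ orliczModular Ψ μ f C < ⊤

/-- The norm `‖f‖_Ψ`: the infimum of all `C > 0` with `∫ Ψ(|f| / C) dμ ≤ 1`. -/
def luxemburgNorm (Ψ : ℝ → ℝ) (μ : Measure S) (f : S → ℂ) : ℝ :=
  sInf {C : ℝ | 0 < C ∧ orliczModular Ψ μ f C ≤ 1}

/-- The Orlicz space `L^Ψ(μ)`, as a set of classes of measurable functions. -/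
def orliczSpace (Ψ : ℝ → ℝ) (μ : Measure S) : Set (S →ₘ[μ] ℂ) :=
  {f | MemOrlicz Ψ μ f}

/-- The weak Orlicz space `L^{Ψ,∞}(μ)`: the classes of measurable functions `f` such that, for
some `c > 0`, `μ(|f| > t) ≤ 1 / Ψ(c t)` for every `t > 0` (where `1 / 0 = ∞`). -/
def weakOrliczSpace (Ψ : ℝ → ℝ) (μ : Measure S) : Set (S →ₘ[μ] ℂ) :=
  {f | ∃ c : ℝ, 0 < c ∧ ∀ t : ℝ, 0 < t →
    μ {s | t < ‖f s‖} ≤ (ENNReal.ofReal (Ψ (c * t)))⁻¹}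

/-- Let `X` carry the norm `N`, let `T` map `X` into classes of measurable functions, and let `Y`
be a space of such classes. `T` is order bounded into `Y` if there is a nonnegative `y` in `Y` with
`|T x| ≤ y` (almost everywhere) for every `x` in the unit ball of `X`. -/
def IsOrderBoundedInto {X : Type*} (N : X → ℝ) {μ : Measure S} (T : X → S →ₘ[μ] ℂ)
    (Y : Set (S →ₘ[μ] ℂ)) : Prop :=
  ∃ y ∈ Y, (∀ᵐ s ∂μ, 0 ≤ (y s).re ∧ (y s).im = 0) ∧
    ∀ x : X, N x ≤ 1 → ∀ᵐ s ∂μ, ‖T x s‖ ≤ (y s).re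

end Spaces

/-- The normalized area measure `𝒜` on the open unit disk of `ℂ`. -/
def diskMeasure : Measure ℂ :=
  (ENNReal.ofReal Real.pi)⁻¹ • volume.restrict (Metric.ball (0 : ℂ) 1)

/-- The normalized Lebesgue measure `m` on the unit circle, as a measure on `ℂ` carried by the
circle: the image under `t ↦ exp(i t)` of `dt / (2π)` on `(0, 2π]`. -/
def circleMeasure : Measure ℂ :=
  (ENNReal.ofReal (2 * Real.pi))⁻¹ •
    (volume.restrict (Ioc (0 : ℝ) (2 * Real.pi))).map (circleMap 0 1)

/-- `f` belongs to the Hardy space `H¹`: it is analytic in the open unit disk and its means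
`(1 / 2π) ∫ |f(r exp(i t))| dt` over the circles of radius `r < 1` are bounded. -/
def MemHardyOne (f : ℂ → ℂ) : Prop :=
  DifferentiableOn ℂ f (Metric.ball 0 1) ∧
    ∃ M : ℝ, ∀ r ∈ Ioo (0 : ℝ) 1, Real.circleAverage (fun z => ‖f z‖) 0 r ≤ M

/-- `f` has a radial limit at almost every point of the circle. -/
def HasRadialLimits (f : ℂ → ℂ) : Prop :=
  ∀ᵐ ξ ∂circleMeasure, ∃ w : ℂ,
    Tendsto (fun r : ℝ => f ((r : ℂ) * ξ)) (𝓝[<] 1) (𝓝 w)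

/-- The boundary values function `f^*` of `f`: `f^*(ξ) = lim_{r → 1⁻} f(r ξ)` for `|ξ| = 1`. -/
def boundaryFunction (f : ℂ → ℂ) (ξ : ℂ) : ℂ :=
  limUnder (𝓝[<] (1 : ℝ)) fun r : ℝ => f ((r : ℂ) * ξ)

/-- The Hardy-Orlicz space `H^Ψ`: the functions `f ∈ H¹` whose boundary values function `f^*`
lies in `L^Ψ(m)`. The condition `HasRadialLimits f` says that `f^*` is defined almost everywhere;
by Fatou's theorem it holds for every `f ∈ H¹`. Functions on the disk are represented by functions
on `ℂ`, and all the conditions here depend only on the values in the disk. -/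
def hardyOrlicz (Ψ : ℝ → ℝ) : Set (ℂ → ℂ) :=
  {f | MemHardyOne f ∧ HasRadialLimits f ∧ MemOrlicz Ψ circleMeasure (boundaryFunction f)}

/-- The norm of `H^Ψ`: `‖f‖ = ‖f^*‖_Ψ`. -/
def hardyOrliczNorm (Ψ : ℝ → ℝ) (f : hardyOrlicz Ψ) : ℝ :=
  luxemburgNorm Ψ circleMeasure (boundaryFunction f)

theorem hardyOrlicz_aestronglyMeasurable {Ψ : ℝ → ℝ} (f : hardyOrlicz Ψ) :
    AEStronglyMeasurable (f : ℂ → ℂ) diskMeasure :=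
  (f.2.1.1.continuousOn.aestronglyMeasurable Metric.isOpen_ball.measurableSet).smul_measure _

/-- The canonical injection `J_Ψ`, sending `f ∈ H^Ψ` to its class in the measurable functions on
the disk `(𝔻, 𝒜)`, where the Bergman-Orlicz space consists of the classes in `L^Ψ(𝔻, 𝒜)` of
analytic functions. -/
def canonicalInjection (Ψ : ℝ → ℝ) (f : hardyOrlicz Ψ) : ℂ →ₘ[diskMeasure] ℂ :=
  AEEqFun.mk (f : ℂ → ℂ) (hardyOrlicz_aestronglyMeasurable f)

end

/-! Let k(z) = Ψ⁻¹(1/(1 - |z|)), with the generalized inverse. Up to constants, k(w) is the supremum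
of |f(w)| over the unit ball of H^Ψ, and k is also a largest member of L^{Ψ,∞}(𝔻, 𝒜), because the
annulus 1 - |z| < s has area comparable to s. Hence both properties say that k lies in L^Ψ(𝔻, 𝒜).

Upper bound for |f(w)| (`norm_le_orliczInv`): √|f(w)| is at most the Poisson integral of √|f^*|.
Jensen's inequality for x ↦ Ψ(x²/2) and the bound (1 + |w|)/(1 - |w|) for the Poisson kernel then
control Ψ(|f(w)|/2). The square root makes the passage to boundary values easy: bounded L¹ means of
f(r·) make the family √|f(r·)| uniformly integrable, so truncation and dominated convergence
suffice.

Lower bound (`ae_orliczInv_le_of_isOrderBound`): the functions Ψ⁻¹(1/(1 - |w|)) ((1 - |w|)/(1 -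
w̄z))² lie in the unit ball, since Ψ of their modulus is at most the Poisson kernel on the circle.

Comparing distributions (`orliczModular_le_of_meas_le`) transfers membership in L^Ψ from an order
bound to every weak Orlicz function. Under Δ¹, a dyadic splitting of the modular bounds it by a
geometric series. -/

/-! ### Orlicz functions and their generalized inverses -/

/-- The generalized inverse of an Orlicz function. -/
noncomputable def orliczInv (Ψ : ℝ → ℝ) (y : ℝ) : ℝ := sSup {x : ℝ | 0 ≤ x ∧ Ψ x ≤ y}

namespace IsOrliczFunction

variable {Ψ : ℝ → ℝ}

lemma nonneg (hΨ : IsOrliczFunction Ψ) {x : ℝ} (hx : 0 ≤ x) : 0 ≤ Ψ x :=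
  hΨ.map_zero ▸ hΨ.monotoneOn (mem_Ici.2 le_rfl) hx hx

lemma mono (hΨ : IsOrliczFunction Ψ) {x y : ℝ} (hx : 0 ≤ x) (hxy : x ≤ y) : Ψ x ≤ Ψ y :=
  hΨ.monotoneOn hx (hx.trans hxy) hxy

lemma map_mul_le (hΨ : IsOrliczFunction Ψ) {t x : ℝ} (ht₀ : 0 ≤ t) (ht₁ : t ≤ 1) (hx : 0 ≤ x) :
    Ψ (t * x) ≤ t * Ψ x := by
  have := hΨ.convexOn.2 (mem_Ici.2 hx) (mem_Ici.2 le_rfl) ht₀ (sub_nonneg.2 ht₁) (by ring)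
  simpa [hΨ.map_zero] using this

/-- Convexity alone gives continuity only in the open half-line; at 0 it comes from 0 ≤ Ψ(x) ≤ x
Ψ(1). -/
lemma continuousOn (hΨ : IsOrliczFunction Ψ) : ContinuousOn Ψ (Ici 0) := by
  intro x hx
  rcases (mem_Ici.1 hx).eq_or_lt with rfl | hx
  · rw [ContinuousWithinAt, hΨ.map_zero]
    have hlim : Tendsto (fun x : ℝ => x * Ψ 1) (𝓝[Ici 0] 0) (𝓝 0) := by
      have : Tendsto (fun x : ℝ => x * Ψ 1) (𝓝 0) (𝓝 (0 * Ψ 1)) :=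
        (continuous_id.mul continuous_const).tendsto 0
      simpa using this.mono_left nhdsWithin_le_nhds
    refine tendsto_of_tendsto_of_tendsto_of_le_of_le' tendsto_const_nhds hlim ?_ ?_
    · filter_upwards [self_mem_nhdsWithin] with x hx using hΨ.nonneg hx
    · filter_upwards [self_mem_nhdsWithin, nhdsWithin_le_nhds (Iio_mem_nhds one_pos)] with x hx hx1
      simpa using hΨ.map_mul_le hx (le_of_lt hx1) zero_le_one
  · have h := hΨ.convexOn.continuousOn_interior
    rw [interior_Ici] at h
    exact (h.continuousAt (Ioi_mem_nhds hx)).continuousWithinAt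

lemma monotone_comp_max (hΨ : IsOrliczFunction Ψ) : Monotone fun x => Ψ (max 0 x) :=
  fun _ _ h => hΨ.mono (le_max_left _ _) (max_le_max le_rfl h)

lemma aemeasurable_comp (hΨ : IsOrliczFunction Ψ) {S : Type*} [MeasurableSpace S] {μ : Measure S}
    {u : S → ℝ} (hu : AEMeasurable u μ) (hu₀ : ∀ s, 0 ≤ u s) :
    AEMeasurable (fun s => Ψ (u s)) μ := by
  have := hΨ.monotone_comp_max.measurable.comp_aemeasurable hu
  refine this.congr (Eventually.of_forall fun s => ?_)
  simp [max_eq_right (hu₀ s)]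

lemma bddAbove_sublevel (hΨ : IsOrliczFunction Ψ) (y : ℝ) :
    BddAbove {x : ℝ | 0 ≤ x ∧ Ψ x ≤ y} := by
  obtain ⟨b, hb⟩ := (hΨ.tendsto_atTop.eventually_gt_atTop y).exists_forall_of_atTop
  exact ⟨b, fun x hx => le_of_not_ge fun h => (hb x h).not_ge hx.2⟩

lemma orliczInv_nonneg (Ψ : ℝ → ℝ) (y : ℝ) : 0 ≤ orliczInv Ψ y :=
  Real.sSup_nonneg fun _ hx => hx.1

lemma map_orliczInv_le (hΨ : IsOrliczFunction Ψ) {y : ℝ} (hy : 0 ≤ y) :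
    Ψ (orliczInv Ψ y) ≤ y := by
  have hcl : IsClosed {x : ℝ | 0 ≤ x ∧ Ψ x ≤ y} :=
    hΨ.continuousOn.preimage_isClosed_of_isClosed isClosed_Ici (isClosed_Iic (a := y))
  exact (hcl.csSup_mem ⟨0, le_rfl, hΨ.map_zero.trans_le hy⟩ (hΨ.bddAbove_sublevel y)).2

/-- Sublevel sets are closed by continuity, so the supremum defining the inverse is attained. This
Galois connection replaces invertibility of Ψ, which may vanish near 0. -/
lemma le_orliczInv_iff (hΨ : IsOrliczFunction Ψ) {x y : ℝ} (hx : 0 ≤ x) (hy : 0 ≤ y) :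
    x ≤ orliczInv Ψ y ↔ Ψ x ≤ y :=
  ⟨fun h => (hΨ.mono hx h).trans (hΨ.map_orliczInv_le hy),
    fun h => le_csSup (hΨ.bddAbove_sublevel y) ⟨hx, h⟩⟩

lemma orliczInv_lt_iff (hΨ : IsOrliczFunction Ψ) {x y : ℝ} (hx : 0 ≤ x) (hy : 0 ≤ y) :
    orliczInv Ψ y < x ↔ y < Ψ x := by
  rw [← not_le, ← not_le, hΨ.le_orliczInv_iff hx hy]

lemma monotone_orliczInv (hΨ : IsOrliczFunction Ψ) : Monotone (orliczInv Ψ) := by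
  intro y z hyz
  refine Real.sSup_le (fun x hx => ?_) (orliczInv_nonneg Ψ z)
  exact le_csSup (hΨ.bddAbove_sublevel z) ⟨hx.1, hx.2.trans hyz⟩

lemma orliczInv_pos (hΨ : IsOrliczFunction Ψ) {y : ℝ} (hy : 0 < y) : 0 < orliczInv Ψ y := by
  have h1 : 0 ≤ Ψ 1 := hΨ.nonneg zero_le_one
  have hs : 0 < y / (Ψ 1 + y) := by positivity
  refine hs.trans_le ((hΨ.le_orliczInv_iff hs.le hy.le).2 ?_)
  have := hΨ.map_mul_le hs.le ((div_le_one (by positivity)).2 (by linarith)) zero_le_one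
  rw [mul_one] at this
  refine this.trans ?_
  rw [div_mul_eq_mul_div, div_le_iff₀ (by positivity)]
  nlinarith

/-! ### Modulars, the Luxemburg norm and distribution functions -/

section Modular

variable {S : Type*} [MeasurableSpace S] {μ : Measure S} {f g : S → ℂ}

lemma orliczModular_anti (hΨ : IsOrliczFunction Ψ) {C D : ℝ} (hC : 0 < C) (hCD : C ≤ D) :
    orliczModular Ψ μ f D ≤ orliczModular Ψ μ f C := by
  refine lintegral_mono fun s => ENNReal.ofReal_le_ofReal (hΨ.mono ?_ ?_)
  · have := hC.trans_le hCD
    positivity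
  · gcongr

/-- By convexity Ψ(x/k) ≤ Ψ(x)/k; enlarging C thus brings any finite modular below 1. -/
lemma orliczModular_mul_le (hΨ : IsOrliczFunction Ψ) {C k : ℝ} (hC : 0 < C) (hk : 1 ≤ k) :
    orliczModular Ψ μ f (C * k) ≤ (ENNReal.ofReal k)⁻¹ * orliczModular Ψ μ f C := by
  have hk₀ : 0 < k := one_pos.trans_le hk
  have hk' : (ENNReal.ofReal k)⁻¹ = ENNReal.ofReal k⁻¹ := (ENNReal.ofReal_inv_of_pos hk₀).symm
  rw [orliczModular, orliczModular, hk', ← lintegral_const_mul' _ _ ENNReal.ofReal_ne_top]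
  refine lintegral_mono fun s => ?_
  rw [← ENNReal.ofReal_mul (by positivity)]
  refine ENNReal.ofReal_le_ofReal ?_
  have := hΨ.map_mul_le (t := k⁻¹) (x := ‖f s‖ / C) (by positivity) (inv_le_one_of_one_le₀ hk)
    (by positivity)
  convert this using 2
  field_simp

lemma exists_orliczModular_le_one (hΨ : IsOrliczFunction Ψ) (hf : MemOrlicz Ψ μ f) :
    ∃ C : ℝ, 0 < C ∧ orliczModular Ψ μ f C ≤ 1 := by
  obtain ⟨-, C, hC, hfin⟩ := hf
  set k : ℝ := max 1 (orliczModular Ψ μ f C).toReal with hk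
  have hk₁ : 1 ≤ k := le_max_left _ _
  refine ⟨C * k, by positivity, (hΨ.orliczModular_mul_le hC hk₁).trans ?_⟩
  rw [mul_comm, ← div_eq_mul_inv]
  refine ENNReal.div_le_of_le_mul ?_
  rw [one_mul, ← ENNReal.ofReal_toReal hfin.ne]
  exact ENNReal.ofReal_le_ofReal (le_max_right _ _)

lemma orliczModular_le_one_of_luxemburgNorm_lt (hΨ : IsOrliczFunction Ψ) (hf : MemOrlicz Ψ μ f)
    {D : ℝ} (hD : luxemburgNorm Ψ μ f < D) : orliczModular Ψ μ f D ≤ 1 := by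
  obtain ⟨C, ⟨hC, hC₁⟩, hCD⟩ := exists_lt_of_csInf_lt (hΨ.exists_orliczModular_le_one hf) hD
  exact (hΨ.orliczModular_anti hC hCD.le).trans hC₁

lemma luxemburgNorm_le (Ψ : ℝ → ℝ) (μ : Measure S) (f : S → ℂ) {C : ℝ} (hC : 0 < C)
    (h : orliczModular Ψ μ f C ≤ 1) : luxemburgNorm Ψ μ f ≤ C :=
  csInf_le ⟨0, fun _ hx => hx.1.le⟩ ⟨hC, h⟩

lemma aemeasurable_map_norm_div (hΨ : IsOrliczFunction Ψ) (hf : AEStronglyMeasurable f μ) {C : ℝ}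
    (hC : 0 < C) : AEMeasurable (fun s => Ψ (‖f s‖ / C)) μ :=
  hΨ.aemeasurable_comp (hf.norm.aemeasurable.div_const C) fun s => by positivity

/-- Markov's inequality for Ψ(|f|/C), where C makes the modular at most 1. -/
lemma orliczSpace_subset_weakOrliczSpace (hΨ : IsOrliczFunction Ψ) :
    orliczSpace Ψ μ ⊆ weakOrliczSpace Ψ μ := by
  intro f hf
  obtain ⟨C, hC, h1⟩ := hΨ.exists_orliczModular_le_one hf
  refine ⟨C⁻¹, by positivity, fun t ht => ?_⟩
  rw [ENNReal.le_inv_iff_mul_le, mul_comm]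
  refine le_trans ?_ h1
  refine le_trans ?_ (mul_meas_ge_le_lintegral₀
    (hΨ.aemeasurable_map_norm_div hf.1 hC).ennreal_ofReal (ENNReal.ofReal (Ψ (C⁻¹ * t))))
  gcongr with s
  intro hs
  refine ENNReal.ofReal_le_ofReal (hΨ.mono (by positivity) ?_)
  rw [inv_mul_eq_div]
  have : t < ‖f s‖ := hs
  gcongr

/-- A distributional comparison: a function whose distribution is dominated by that of a member of
the Orlicz space belongs to the Orlicz space. -/
lemma orliczModular_le_of_meas_le (hΨ : IsOrliczFunction Ψ) (hf : AEStronglyMeasurable f μ)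
    (hg : AEStronglyMeasurable g μ) {c : ℝ} (hc : 0 < c)
    (h : ∀ t : ℝ, 0 < t → μ {s | t < ‖f s‖} ≤ μ {s | c * t < ‖g s‖}) {C : ℝ} (hC : 0 < C) :
    orliczModular Ψ μ f (C / c) ≤ orliczModular Ψ μ g C := by
  -- Layer-cake formula: the level sets Ψ(|f|/D) > s are the sets |f| > D Ψ⁻¹(s), to which the
  -- hypothesis applies because Ψ⁻¹(s) > 0.
  rw [orliczModular, orliczModular, lintegral_eq_lintegral_meas_lt, lintegral_eq_lintegral_meas_lt]
  · refine setLIntegral_mono' measurableSet_Ioi fun s hs => ?_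
    have hs : 0 < s := hs
    have hp : 0 < orliczInv Ψ s := hΨ.orliczInv_pos hs
    have e1 : {a | s < Ψ (‖f a‖ / (C / c))} = {a | C / c * orliczInv Ψ s < ‖f a‖} := by
      ext a
      rw [mem_ofPred, mem_ofPred, ← hΨ.orliczInv_lt_iff (by positivity) hs.le,
        lt_div_iff₀ (by positivity), mul_comm]
    have e2 : {a | s < Ψ (‖g a‖ / C)} = {a | c * (C / c * orliczInv Ψ s) < ‖g a‖} := by
      ext a
      rw [mem_ofPred, mem_ofPred, ← hΨ.orliczInv_lt_iff (by positivity) hs.le,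
        lt_div_iff₀ (by positivity), mul_comm, ← mul_assoc, mul_div_cancel₀ _ hc.ne']
    rw [e1, e2]
    exact h _ (by positivity)
  · exact Eventually.of_forall fun s => hΨ.nonneg (by positivity)
  · exact hΨ.aemeasurable_map_norm_div hg hC
  · exact Eventually.of_forall fun s => hΨ.nonneg (by positivity)
  · exact hΨ.aemeasurable_map_norm_div hf (by positivity)

end Modular

end IsOrliczFunction

/-! ### The area measure of annuli and the circle measure -/

instance isProbabilityMeasure_diskMeasure : IsProbabilityMeasure diskMeasure := by
  constructor
  have : (NNReal.pi : ENNReal) = ENNReal.ofReal Real.pi := by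
    rw [← NNReal.coe_real_pi, ENNReal.ofReal_coe_nnreal]
  simp [diskMeasure, this]
  exact ENNReal.inv_mul_cancel (by simp [Real.pi_pos]) ENNReal.ofReal_ne_top

lemma ae_diskMeasure_mem_ball : ∀ᵐ z ∂diskMeasure, z ∈ Metric.ball (0 : ℂ) 1 :=
  Measure.ae_smul_measure (ae_restrict_mem measurableSet_ball) _

lemma diskMeasure_closedBall {r : ℝ} (hr₀ : 0 ≤ r) (hr₁ : r < 1) :
    diskMeasure (Metric.closedBall 0 r) = ENNReal.ofReal (r ^ 2) := by
  have : (NNReal.pi : ENNReal) = ENNReal.ofReal Real.pi := by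
    rw [← NNReal.coe_real_pi, ENNReal.ofReal_coe_nnreal]
  rw [diskMeasure, Measure.smul_apply, Measure.restrict_apply measurableSet_closedBall,
    inter_eq_left.2 (Metric.closedBall_subset_ball hr₁), Complex.volume_closedBall, this,
    smul_eq_mul, mul_comm, mul_assoc, ENNReal.mul_inv_cancel (by simp [Real.pi_pos])
    ENNReal.ofReal_ne_top, mul_one, ENNReal.ofReal_pow hr₀]

lemma diskMeasure_lt_norm {r : ℝ} (hr₀ : 0 ≤ r) (hr₁ : r < 1) :
    diskMeasure {z | r < ‖z‖} = ENNReal.ofReal (1 - r ^ 2) := by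
  have : {z : ℂ | r < ‖z‖} = (Metric.closedBall 0 r)ᶜ := by ext; simp
  rw [this, prob_compl_eq_one_sub measurableSet_closedBall, diskMeasure_closedBall hr₀ hr₁,
    ENNReal.ofReal_sub _ (sq_nonneg r), ENNReal.ofReal_one]

lemma diskMeasure_lt_norm_le {s : ℝ} (hs : 0 < s) :
    diskMeasure {z | 1 - s < ‖z‖} ≤ ENNReal.ofReal (2 * s) := by
  rcases lt_or_ge 1 s with h | h
  · refine prob_le_one.trans ?_
    rw [← ENNReal.ofReal_one]
    exact ENNReal.ofReal_le_ofReal (by linarith)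
  · rw [diskMeasure_lt_norm (by linarith) (by linarith)]
    exact ENNReal.ofReal_le_ofReal (by nlinarith)

lemma le_diskMeasure_lt_norm {s : ℝ} (hs₀ : 0 < s) (hs : s ≤ 1) :
    ENNReal.ofReal s ≤ diskMeasure {z | 1 - s < ‖z‖} := by
  rw [diskMeasure_lt_norm (by linarith) (by linarith)]
  exact ENNReal.ofReal_le_ofReal (by nlinarith)

instance isProbabilityMeasure_circleMeasure : IsProbabilityMeasure circleMeasure := by
  constructor
  rw [circleMeasure, Measure.smul_apply, Measure.map_apply (by fun_prop) MeasurableSet.univ]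
  simp only [preimage_univ, Measure.restrict_apply_univ, Real.volume_Ioc, sub_zero, smul_eq_mul]
  exact ENNReal.inv_mul_cancel (by simp [Real.pi_pos]) ENNReal.ofReal_ne_top

lemma ae_circleMeasure_mem_sphere : ∀ᵐ z ∂circleMeasure, z ∈ Metric.sphere (0 : ℂ) 1 := by
  refine Measure.ae_smul_measure ?_ _
  refine (ae_map_iff (p := fun z => z ∈ Metric.sphere (0 : ℂ) 1) (by fun_prop)
    Metric.isClosed_sphere.measurableSet).2 ?_
  exact Eventually.of_forall fun t => by simp

lemma integral_circleMeasure {f : ℂ → ℝ} (hf : AEStronglyMeasurable f circleMeasure) :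
    ∫ z, f z ∂circleMeasure = Real.circleAverage f 0 1 := by
  have hpos : (0 : ℝ) < 2 * Real.pi := by positivity
  have hf' : AEStronglyMeasurable f
      ((volume.restrict (Ioc (0 : ℝ) (2 * Real.pi))).map (circleMap 0 1)) := by
    exact hf.mono_ac (Measure.absolutelyContinuous_smul
      (ENNReal.inv_ne_zero.2 ENNReal.ofReal_ne_top))
  rw [circleMeasure, integral_smul_measure, integral_map (by fun_prop) hf',
    Real.circleAverage, intervalIntegral.integral_of_le hpos.le, ENNReal.toReal_inv,
    ENNReal.toReal_ofReal hpos.le]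

lemma aestronglyMeasurable_circleMeasure {f : ℂ → ℝ}
    (hf : ContinuousOn f (Metric.sphere 0 1)) : AEStronglyMeasurable f circleMeasure := by
  have h := hf.aestronglyMeasurable (μ := circleMeasure) Metric.isClosed_sphere.measurableSet
  rwa [Measure.restrict_eq_self_of_ae_mem ae_circleMeasure_mem_sphere] at h

/-! ### Harmonic measure and the Poisson kernel -/

/-- The harmonic measure of the unit disk at the point `w`, whose density is the Poisson kernel. -/
noncomputable def diskHarmonicMeasure (w : ℂ) : Measure ℂ :=
  circleMeasure.withDensity fun z => ENNReal.ofReal (poissonKernel 0 w z)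

section HarmonicMeasure

variable {w : ℂ}

lemma poissonKernel_nonneg_of_mem_sphere (hw : w ∈ Metric.ball (0 : ℂ) 1) {z : ℂ}
    (hz : z ∈ Metric.sphere (0 : ℂ) 1) : 0 ≤ poissonKernel 0 w z := by
  have hw : ‖w‖ < 1 := by simpa using hw
  have hz : ‖z‖ = 1 := by simpa using hz
  rw [poissonKernel_def, sub_zero, sub_zero, hz]
  have : ‖w‖ ^ 2 ≤ 1 := by nlinarith [norm_nonneg w]
  have : 0 ≤ 1 ^ 2 - ‖w‖ ^ 2 := by linarith
  positivity

lemma poissonKernel_le_of_mem_sphere (hw : w ∈ Metric.ball (0 : ℂ) 1) {z : ℂ}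
    (hz : z ∈ Metric.sphere (0 : ℂ) 1) :
    poissonKernel 0 w z ≤ (1 + ‖w‖) / (1 - ‖w‖) := by
  have := re_herglotzRieszKernel_le hz hw
  rw [poissonKernel_eq_re_herglotzRieszKernel]
  simpa [herglotzRieszKernel_def] using this

lemma continuousOn_poissonKernel (hw : w ∈ Metric.ball (0 : ℂ) 1) :
    ContinuousOn (poissonKernel 0 w) (Metric.sphere 0 1) := by
  have hw : ‖w‖ < 1 := by simpa using hw
  have : poissonKernel 0 w = fun z => (‖z - 0‖ ^ 2 - ‖w - 0‖ ^ 2) / ‖(z - 0) - (w - 0)‖ ^ 2 :=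
    funext fun z => poissonKernel_def 0 w z
  rw [this]
  refine ContinuousOn.div (by fun_prop) (by fun_prop) fun z hz h => ?_
  have hz : ‖z‖ = 1 := by simpa using hz
  have : z = w := by simpa [sub_eq_zero] using h
  rw [this] at hz
  linarith

lemma measurable_poissonKernel (w : ℂ) : Measurable (poissonKernel 0 w) := by
  have : poissonKernel 0 w = fun z => (‖z - 0‖ ^ 2 - ‖w - 0‖ ^ 2) / ‖(z - 0) - (w - 0)‖ ^ 2 :=
    funext fun z => poissonKernel_def 0 w z
  rw [this]
  fun_prop

lemma integral_diskHarmonicMeasure (hw : w ∈ Metric.ball (0 : ℂ) 1) (u : ℂ → ℝ) :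
    ∫ z, u z ∂diskHarmonicMeasure w = ∫ z, poissonKernel 0 w z * u z ∂circleMeasure := by
  rw [diskHarmonicMeasure, integral_withDensity_eq_integral_toReal_smul
    (measurable_poissonKernel w).ennreal_ofReal (Eventually.of_forall fun _ => ENNReal.ofReal_lt_top)]
  refine integral_congr_ae ?_
  filter_upwards [ae_circleMeasure_mem_sphere] with z hz
  rw [ENNReal.toReal_ofReal (poissonKernel_nonneg_of_mem_sphere hw hz), smul_eq_mul]

lemma diskHarmonicMeasure_absolutelyContinuous (w : ℂ) :
    diskHarmonicMeasure w ≪ circleMeasure :=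
  withDensity_absolutelyContinuous _ _

lemma ae_diskHarmonicMeasure_mem_sphere (w : ℂ) :
    ∀ᵐ z ∂diskHarmonicMeasure w, z ∈ Metric.sphere (0 : ℂ) 1 :=
  (diskHarmonicMeasure_absolutelyContinuous w).ae_le ae_circleMeasure_mem_sphere

lemma lintegral_diskHarmonicMeasure_le (hw : w ∈ Metric.ball (0 : ℂ) 1) (u : ℂ → ENNReal) :
    ∫⁻ z, u z ∂diskHarmonicMeasure w
      ≤ ENNReal.ofReal ((1 + ‖w‖) / (1 - ‖w‖)) * ∫⁻ z, u z ∂circleMeasure := by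
  rw [← smul_eq_mul, ← lintegral_smul_measure]
  refine lintegral_mono' ?_ le_rfl
  rw [diskHarmonicMeasure, ← withDensity_const]
  refine withDensity_mono ?_
  filter_upwards [ae_circleMeasure_mem_sphere] with z hz
  exact ENNReal.ofReal_le_ofReal (poissonKernel_le_of_mem_sphere hw hz)

lemma integral_poissonKernel (hw : w ∈ Metric.ball (0 : ℂ) 1) :
    ∫ z, poissonKernel 0 w z ∂circleMeasure = 1 := by
  rw [integral_circleMeasure (measurable_poissonKernel w).aestronglyMeasurable]
  have := (diffContOnCl_const (𝕜 := ℂ) (s := Metric.ball (0 : ℂ) 1)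
    (c := (1 : ℂ))).circleAverage_poissonKernel_smul hw
  have h2 : Real.circleAverage (poissonKernel 0 w • fun _ : ℂ => (1 : ℂ)) 0 1
      = ((Real.circleAverage (poissonKernel 0 w) 0 1 : ℝ) : ℂ) := by
    simp [Real.circleAverage, ← intervalIntegral.integral_ofReal]
  rw [h2] at this
  exact_mod_cast this

lemma lintegral_poissonKernel (hw : w ∈ Metric.ball (0 : ℂ) 1) :
    ∫⁻ z, ENNReal.ofReal (poissonKernel 0 w z) ∂circleMeasure = 1 := by
  rw [← ofReal_integral_eq_lintegral_ofReal, integral_poissonKernel hw, ENNReal.ofReal_one]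
  -- A non-integrable kernel would have integral 0 by convention, but its integral is 1.
  · by_contra h
    have := integral_poissonKernel hw
    rw [integral_undef h] at this
    exact zero_ne_one this
  · filter_upwards [ae_circleMeasure_mem_sphere] with z hz
    exact poissonKernel_nonneg_of_mem_sphere hw hz

lemma isProbabilityMeasure_diskHarmonicMeasure (hw : w ∈ Metric.ball (0 : ℂ) 1) :
    IsProbabilityMeasure (diskHarmonicMeasure w) := by
  constructor
  rw [diskHarmonicMeasure, withDensity_apply _ MeasurableSet.univ, Measure.restrict_univ,
    lintegral_poissonKernel hw]

lemma integrable_diskHarmonicMeasure (hw : w ∈ Metric.ball (0 : ℂ) 1) {u : ℂ → ℝ}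
    (hu : ContinuousOn u (Metric.sphere 0 1)) : Integrable u (diskHarmonicMeasure w) := by
  have := isProbabilityMeasure_diskHarmonicMeasure hw
  obtain ⟨C, hC⟩ := (isCompact_sphere (0 : ℂ) 1).exists_bound_of_continuousOn hu
  refine Integrable.of_bound ((aestronglyMeasurable_circleMeasure hu).mono_ac
    (diskHarmonicMeasure_absolutelyContinuous w)) C ?_
  filter_upwards [ae_diskHarmonicMeasure_mem_sphere w] with z hz using hC z hz

lemma norm_le_integral_diskHarmonicMeasure (hw : w ∈ Metric.ball (0 : ℂ) 1) {g : ℂ → ℂ}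
    (hg : DiffContOnCl ℂ g (Metric.ball 0 1)) :
    ‖g w‖ ≤ ∫ z, ‖g z‖ ∂diskHarmonicMeasure w := by
  have hgc : ContinuousOn g (Metric.sphere 0 1) :=
    hg.continuousOn_ball.mono Metric.sphere_subset_closedBall
  rw [integral_diskHarmonicMeasure hw, integral_circleMeasure (aestronglyMeasurable_circleMeasure
    (ContinuousOn.fun_mul (continuousOn_poissonKernel hw) hgc.norm)),
    ← hg.circleAverage_poissonKernel_smul hw, Real.circleAverage, Real.circleAverage, norm_smul,
    smul_eq_mul, Real.norm_of_nonneg (by positivity)]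
  refine mul_le_mul_of_nonneg_left ?_ (by positivity)
  refine (intervalIntegral.norm_integral_le_integral_norm (by positivity)).trans_eq ?_
  refine intervalIntegral.integral_congr fun t _ => ?_
  have := poissonKernel_nonneg_of_mem_sphere hw (z := circleMap 0 1 t) (by simp)
  simp [abs_of_nonneg this]

end HarmonicMeasure

/-! ### Subharmonicity of the square root of the modulus -/

/-- Every real continuous function on the unit circle is uniformly approximated by real parts of
entire functions. -/
lemma exists_differentiable_re_approx {φ : ℂ → ℝ} (hφ : ContinuousOn φ (Metric.sphere 0 1)) {δ : ℝ}
    (hδ : 0 < δ) :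
    ∃ q : ℂ → ℂ, Differentiable ℂ q ∧ ∀ z ∈ Metric.sphere (0 : ℂ) 1, |(q z).re - φ z| < δ := by
  have hmem (x : UnitAddCircle) : (AddCircle.toCircle x : ℂ) ∈ Metric.sphere (0 : ℂ) 1 :=
    mem_sphere_zero_iff_norm.2 (Circle.norm_coe _)
  let F : C(UnitAddCircle, ℂ) :=
    ⟨fun x => (φ (AddCircle.toCircle x) : ℂ), Complex.continuous_ofReal.comp
      (hφ.comp_continuous (continuous_subtype_val.comp AddCircle.continuous_toCircle) hmem)⟩
  have hF : F ∈ closure (Submodule.span ℂ (range (fourier (T := (1 : ℝ)))) :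
      Set C(UnitAddCircle, ℂ)) := by
    rw [← Submodule.topologicalClosure_coe, span_fourier_closure_eq_top]
    trivial
  obtain ⟨p, hp, hFp⟩ := Metric.mem_closure_iff.1 hF δ hδ
  have key : ∃ q : ℂ → ℂ, Differentiable ℂ q ∧
      ∀ x : UnitAddCircle, (p x).re = (q (AddCircle.toCircle x)).re := by
    clear hFp
    induction hp using Submodule.closure_induction with
    | zero => exact ⟨fun _ => 0, by fun_prop, by simp⟩
    | add p₁ p₂ _ _ h₁ h₂ =>
      obtain ⟨q₁, hq₁, e₁⟩ := h₁
      obtain ⟨q₂, hq₂, e₂⟩ := h₂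
      exact ⟨fun z => q₁ z + q₂ z, by fun_prop, fun x => by simp [e₁, e₂]⟩
    | smul_mem c p hp =>
      obtain ⟨n, rfl⟩ := hp
      obtain ⟨k, rfl | rfl⟩ := n.eq_nat_or_neg
      · refine ⟨fun z => c * z ^ k, by fun_prop, fun x => ?_⟩
        simp only [ContinuousMap.smul_apply, fourier_apply, AddCircle.toCircle_zsmul, smul_eq_mul]
        simp
      -- On the circle c z⁻ᵏ is the conjugate of c̄ zᵏ, so a negative frequency has the real part of
      -- an entire function.
      · refine ⟨fun z => (starRingEnd ℂ) c * z ^ k, by fun_prop, fun x => ?_⟩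
        rw [ContinuousMap.smul_apply, fourier_neg, smul_eq_mul, ← Complex.conj_re]
        simp only [map_mul, Complex.conj_conj, fourier_apply, AddCircle.toCircle_zsmul]
        simp
  obtain ⟨q, hq, hpq⟩ := key
  refine ⟨q, hq, fun z hz => ?_⟩
  obtain ⟨x, hx⟩ := (AddCircle.homeomorphCircle (T := (1 : ℝ)) one_ne_zero).surjective
    ⟨z, hz⟩
  have hx' : (AddCircle.toCircle x : ℂ) = z := by
    rw [← AddCircle.homeomorphCircle_apply one_ne_zero, hx]
  have h1 := (ContinuousMap.dist_apply_le_dist x).trans_lt hFp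
  have h2 : |(F x - p x).re| ≤ ‖F x - p x‖ := Complex.abs_re_le_norm _
  rw [← dist_eq_norm] at h2
  have h3 : (F x - p x).re = φ z - (q z).re := by
    rw [Complex.sub_re, hpq, hx']
    simp [F, hx']
  rw [abs_sub_comm, ← h3]
  exact h2.trans_lt h1

/-- The square root of the modulus of an analytic function is subharmonic. -/
lemma sqrt_norm_le_integral_diskHarmonicMeasure {w : ℂ} (hw : w ∈ Metric.ball (0 : ℂ) 1)
    {g : ℂ → ℂ} (hg : DiffContOnCl ℂ g (Metric.ball 0 1)) :
    √‖g w‖ ≤ ∫ z, √‖g z‖ ∂diskHarmonicMeasure w := by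
  have := isProbabilityMeasure_diskHarmonicMeasure hw
  have hgc : ContinuousOn g (Metric.sphere 0 1) :=
    hg.continuousOn_ball.mono Metric.sphere_subset_closedBall
  set I := ∫ z, √‖g z‖ ∂diskHarmonicMeasure w with hI
  have key : ∀ δ : ℝ, 0 < δ → √‖g w‖ ≤ Real.exp δ * (I + √δ) := by
    intro δ hδ
    have hpos (z : ℂ) : 0 < ‖g z‖ + δ := by positivity
    obtain ⟨q, hq, hqφ⟩ := exists_differentiable_re_approx (φ := fun z => Real.log (‖g z‖ + δ))
      ((hgc.norm.add continuousOn_const).log fun z _ => (hpos z).ne') hδ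
    -- With Re q within δ of log(|g| + δ) on the circle, the maximum principle applies to g e^{-q}.
    -- Zeros of g do no harm thanks to the shift by δ; the zero-free function e^{q/2} then plays the
    -- role of a square root of g.
    have hmax : ‖g w * Complex.exp (-q w)‖ ≤ Real.exp δ := by
      refine Complex.norm_le_of_forall_mem_frontier_norm_le Metric.isBounded_ball
        (f := fun z => g z * Complex.exp (-q z)) (U := Metric.ball 0 1) ?_ ?_ (subset_closure hw)
      · have : Differentiable ℂ fun z => Complex.exp (-q z) := by fun_prop
        exact hg.smul this.diffContOnCl
      · intro z hz
        rw [frontier_ball _ one_ne_zero] at hz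
        have h1 := (abs_lt.1 (hqφ z hz)).1
        rw [norm_mul, Complex.norm_exp, Complex.neg_re]
        calc ‖g z‖ * Real.exp (-(q z).re)
            ≤ (‖g z‖ + δ) * Real.exp (δ - Real.log (‖g z‖ + δ)) := by
              gcongr
              · linarith
              · linarith
          _ = Real.exp δ := by
              rw [Real.exp_sub, Real.exp_log (hpos z), mul_div_cancel₀ _ (hpos z).ne']
    have hsqrt_exp (x : ℝ) : √(Real.exp x) = Real.exp (x / 2) := by
      rw [Real.sqrt_eq_iff_mul_self_eq (Real.exp_pos _).le (Real.exp_pos _).le, ← Real.exp_add,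
        add_halves]
    have h1 : √‖g w‖ ≤ Real.exp (δ / 2) * ‖Complex.exp (q w / 2)‖ := by
      rw [norm_mul, Complex.norm_exp, Complex.neg_re, Real.exp_neg, ← div_eq_mul_inv,
        div_le_iff₀ (Real.exp_pos _), ← Real.exp_add] at hmax
      refine (Real.sqrt_le_sqrt hmax).trans_eq ?_
      rw [hsqrt_exp, Complex.norm_exp, ← Real.exp_add, add_div]
      simp
    have h2 : ‖Complex.exp (q w / 2)‖ ≤ ∫ z, ‖Complex.exp (q z / 2)‖ ∂diskHarmonicMeasure w := by
      have : Differentiable ℂ fun z => Complex.exp (q z / 2) := by fun_prop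
      exact norm_le_integral_diskHarmonicMeasure hw this.diffContOnCl
    have hsq : Integrable (fun z => √‖g z‖) (diskHarmonicMeasure w) :=
      integrable_diskHarmonicMeasure hw hgc.norm.sqrt
    have h3 : ∫ z, ‖Complex.exp (q z / 2)‖ ∂diskHarmonicMeasure w
        ≤ ∫ z, Real.exp (δ / 2) * (√‖g z‖ + √δ) ∂diskHarmonicMeasure w := by
      refine integral_mono_ae (integrable_diskHarmonicMeasure hw ?_)
        ((hsq.add (integrable_const _)).const_mul _) ?_
      · have := hq.continuous
        exact Continuous.continuousOn (by fun_prop)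
      · filter_upwards [ae_diskHarmonicMeasure_mem_sphere w] with z hz
        have h1 := (abs_lt.1 (hqφ z hz)).2
        calc ‖Complex.exp (q z / 2)‖ = Real.exp ((q z).re / 2) := by
              rw [Complex.norm_exp]
              simp
          _ ≤ Real.exp (δ / 2 + Real.log (‖g z‖ + δ) / 2) := Real.exp_le_exp.2 (by linarith)
          _ = Real.exp (δ / 2) * √(‖g z‖ + δ) := by
              rw [Real.exp_add, ← hsqrt_exp (Real.log _), Real.exp_log (hpos z)]
          _ ≤ Real.exp (δ / 2) * (√‖g z‖ + √δ) := by
              gcongr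
              rw [Real.sqrt_le_left (by positivity), add_sq, Real.sq_sqrt (norm_nonneg _),
                Real.sq_sqrt hδ.le]
              have : 0 ≤ 2 * √‖g z‖ * √δ := by positivity
              linarith
    calc √‖g w‖ ≤ Real.exp (δ / 2) * (Real.exp (δ / 2) * (I + √δ)) := by
          refine h1.trans (mul_le_mul_of_nonneg_left ((h2.trans h3).trans_eq ?_)
            (Real.exp_pos _).le)
          rw [integral_const_mul, integral_add hsq (integrable_const _)]
          simp [hI]
      _ = Real.exp δ * (I + √δ) := by rw [← mul_assoc, ← Real.exp_add, add_halves]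
  have hlim : Tendsto (fun δ : ℝ => Real.exp δ * (I + √δ)) (𝓝[>] 0) (𝓝 I) := by
    have : Continuous fun δ : ℝ => Real.exp δ * (I + √δ) := by fun_prop
    simpa using (this.tendsto 0).mono_left nhdsWithin_le_nhds
  exact ge_of_tendsto hlim (eventually_mem_nhdsWithin.mono fun δ hδ => key δ hδ)

/-! ### Passage to boundary values in H¹ -/

lemma HasRadialLimits.ae_tendsto {f : ℂ → ℂ} (h : HasRadialLimits f) :
    ∀ᵐ ξ ∂circleMeasure, Tendsto (fun r : ℝ => f ((r : ℂ) * ξ)) (𝓝[<] 1)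
      (𝓝 (boundaryFunction f ξ)) := by
  filter_upwards [h] with ξ hξ using tendsto_nhds_limUnder hξ

lemma diffContOnCl_comp_mul {f : ℂ → ℂ} (hf : DifferentiableOn ℂ f (Metric.ball 0 1)) {r : ℝ}
    (hr : r ∈ Ioo (0 : ℝ) 1) : DiffContOnCl ℂ (fun z => f (r * z)) (Metric.ball 0 1) := by
  refine DifferentiableOn.diffContOnCl (hf.comp (by fun_prop) fun z hz => ?_)
  rw [closure_ball _ one_ne_zero, mem_closedBall_zero_iff] at hz
  rw [mem_ball_zero_iff, norm_mul, Complex.norm_of_nonneg hr.1.le]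
  nlinarith [hr.1, hr.2]

/-- A truncated form of the inequality `√|f| ≤ P[√|f^*|]` for functions of the Hardy space `H¹`. -/
lemma sqrt_norm_le_integral_min_add {f : ℂ → ℂ} (hf : DifferentiableOn ℂ f (Metric.ball 0 1))
    {B : ℝ} (hB : ∀ r ∈ Ioo (0 : ℝ) 1, Real.circleAverage (fun z => ‖f z‖) 0 r ≤ B)
    (hlim : HasRadialLimits f) {w : ℂ} (hw : w ∈ Metric.ball (0 : ℂ) 1) {M : ℝ} (hM : 0 < M) :
    √‖f w‖ ≤ ∫ z, min √‖boundaryFunction f z‖ M ∂diskHarmonicMeasure w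
      + (1 + ‖w‖) / (1 - ‖w‖) * B / M := by
  have := isProbabilityMeasure_diskHarmonicMeasure hw
  have hev : ∀ᶠ r : ℝ in 𝓝[<] 1, r ∈ Ioo (0 : ℝ) 1 := Ioo_mem_nhdsLT one_pos
  have hcont {r : ℝ} (hr : r ∈ Ioo (0 : ℝ) 1) :
      ContinuousOn (fun z : ℂ => f (r * z)) (Metric.sphere 0 1) :=
    (diffContOnCl_comp_mul hf hr).continuousOn_ball.mono Metric.sphere_subset_closedBall
  have hmin {r : ℝ} (hr : r ∈ Ioo (0 : ℝ) 1) :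
      ContinuousOn (fun z : ℂ => min √‖f (r * z)‖ M) (Metric.sphere 0 1) :=
    (hcont hr).norm.sqrt.inf continuousOn_const
  have hstep : ∀ r ∈ Ioo (0 : ℝ) 1, √‖f (r * w)‖ ≤
      ∫ z, min √‖f (r * z)‖ M ∂diskHarmonicMeasure w + (1 + ‖w‖) / (1 - ‖w‖) * B / M := by
    intro r hr
    have hi := integrable_diskHarmonicMeasure hw (hmin hr)
    have hn := integrable_diskHarmonicMeasure hw (hcont hr).norm
    have hbound : ∫ z, ‖f (r * z)‖ ∂diskHarmonicMeasure w ≤ (1 + ‖w‖) / (1 - ‖w‖) * B := by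
      have hw' : ‖w‖ < 1 := by simpa using hw
      have hK : 0 ≤ (1 + ‖w‖) / (1 - ‖w‖) := div_nonneg (by positivity) (by linarith)
      have h1 : ∫ z, ‖f (r * z)‖ ∂circleMeasure ≤ B := by
        rw [integral_circleMeasure (aestronglyMeasurable_circleMeasure (hcont hr).norm)]
        have := hB r hr
        rw [Real.circleAverage_eq_circleAverage_zero_one] at this
        simpa using this
      rw [integral_eq_lintegral_of_nonneg_ae (Eventually.of_forall fun _ => norm_nonneg _)
        hn.aestronglyMeasurable]
      refine ENNReal.toReal_le_of_le_ofReal (mul_nonneg hK ?_) ?_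
      · exact (integral_nonneg fun _ => norm_nonneg _).trans h1
      · refine (lintegral_diskHarmonicMeasure_le hw _).trans ?_
        rw [ENNReal.ofReal_mul hK, ← ofReal_integral_eq_lintegral_ofReal]
        · gcongr
        · obtain ⟨C, hC⟩ := (isCompact_sphere (0 : ℂ) 1).exists_bound_of_continuousOn (hcont hr)
          refine Integrable.of_bound (aestronglyMeasurable_circleMeasure (hcont hr).norm) C ?_
          filter_upwards [ae_circleMeasure_mem_sphere] with z hz
          simpa using hC z hz
        · exact Eventually.of_forall fun _ => norm_nonneg _
    calc √‖f (r * w)‖ ≤ ∫ z, √‖f (r * z)‖ ∂diskHarmonicMeasure w :=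
          sqrt_norm_le_integral_diskHarmonicMeasure hw (diffContOnCl_comp_mul hf hr)
      -- Here √x ≤ min(√x, M) + x/M, because √x ≥ M implies √x ≤ x/M.
      _ ≤ ∫ z, (min √‖f (r * z)‖ M + ‖f (r * z)‖ / M) ∂diskHarmonicMeasure w := by
          refine integral_mono (integrable_diskHarmonicMeasure hw (hcont hr).norm.sqrt)
            (hi.add (hn.div_const M)) fun z => ?_
          dsimp only
          have hx := Real.sqrt_nonneg ‖f (r * z)‖
          have hsq := Real.sq_sqrt (norm_nonneg (f (r * z)))
          rcases le_total √‖f (r * z)‖ M with h | h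
          · rw [min_eq_left h]
            have : 0 ≤ ‖f (r * z)‖ / M := by positivity
            linarith
          · rw [min_eq_right h]
            have : √‖f (r * z)‖ ≤ ‖f (r * z)‖ / M := by
              rw [le_div_iff₀ hM]
              nlinarith
            linarith
      _ ≤ _ := by
          rw [integral_add hi (hn.div_const M), integral_div]
          gcongr
  have hL : Tendsto (fun r : ℝ => √‖f (r * w)‖) (𝓝[<] 1) (𝓝 √‖f w‖) := by
    have h1 : Tendsto (fun r : ℝ => (r : ℂ) * w) (𝓝[<] 1) (𝓝 w) := by
      have : Continuous fun r : ℝ => (r : ℂ) * w := by fun_prop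
      simpa using (this.tendsto 1).mono_left nhdsWithin_le_nhds
    have h2 : ContinuousAt f w := hf.continuousOn.continuousAt (Metric.isOpen_ball.mem_nhds hw)
    exact (h2.tendsto.comp h1).norm.sqrt
  -- The truncated integrands are dominated by M, so radial limits pass under the integral.
  have hR : Tendsto (fun r : ℝ => ∫ z, min √‖f (r * z)‖ M ∂diskHarmonicMeasure w) (𝓝[<] 1)
      (𝓝 (∫ z, min √‖boundaryFunction f z‖ M ∂diskHarmonicMeasure w)) := by
    refine tendsto_integral_filter_of_dominated_convergence (fun _ => M) ?_ ?_
      (integrable_const _) ?_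
    · filter_upwards [hev] with r hr
      exact (integrable_diskHarmonicMeasure hw (hmin hr)).aestronglyMeasurable
    · refine Eventually.of_forall fun r => Eventually.of_forall fun z => ?_
      rw [Real.norm_of_nonneg (le_min (Real.sqrt_nonneg _) hM.le)]
      exact min_le_right _ _
    · filter_upwards [(diskHarmonicMeasure_absolutelyContinuous w).ae_le hlim.ae_tendsto] with z hz
      exact hz.norm.sqrt.min tendsto_const_nhds
  exact le_of_tendsto_of_tendsto hL (hR.add_const _) (hev.mono hstep)

/-! ### Pointwise growth in the Hardy-Orlicz unit ball -/

namespace IsOrliczFunction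

variable {Ψ : ℝ → ℝ}

lemma convexOn_comp_sq_div_two (hΨ : IsOrliczFunction Ψ) :
    ConvexOn ℝ (Ici 0) fun x => Ψ (x ^ 2 / 2) := by
  refine ⟨convex_Ici 0, fun x hx y hy a b ha hb hab => ?_⟩
  have hx' : (0 : ℝ) ≤ x ^ 2 / 2 := by positivity
  have hy' : (0 : ℝ) ≤ y ^ 2 / 2 := by positivity
  refine le_trans (hΨ.mono (by positivity) ?_) (hΨ.convexOn.2 hx' hy' ha hb hab)
  simp only [smul_eq_mul]
  obtain rfl : b = 1 - a := by linarith
  nlinarith [mul_nonneg (mul_nonneg ha hb) (sq_nonneg (x - y))]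

/-- The pointwise growth of functions in the unit ball of a Hardy-Orlicz space. -/
lemma norm_le_orliczInv (hΨ : IsOrliczFunction Ψ) (f : hardyOrlicz Ψ)
    (hf : hardyOrliczNorm Ψ f ≤ 1) {w : ℂ} (hw : w ∈ Metric.ball (0 : ℂ) 1) :
    ‖(f : ℂ → ℂ) w‖ ≤ 2 * orliczInv Ψ ((1 + ‖w‖) / (1 - ‖w‖)) := by
  obtain ⟨f, ⟨hd, B, hB⟩, hlim, hmem⟩ := f
  have := isProbabilityMeasure_diskHarmonicMeasure hw
  -- The modular is at most 1 at every constant above the norm; 2 is a convenient choice and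
  -- reappears in x²/2.
  have hmod : orliczModular Ψ circleMeasure (boundaryFunction f) 2 ≤ 1 :=
    hΨ.orliczModular_le_one_of_luxemburgNorm_lt hmem (hf.trans_lt one_lt_two)
  have hw' : ‖w‖ < 1 := by simpa using hw
  set K := (1 + ‖w‖) / (1 - ‖w‖) with hKdef
  have hK : 0 ≤ K := div_nonneg (by positivity) (by linarith)
  set b := boundaryFunction f
  have hb : AEStronglyMeasurable b (diskHarmonicMeasure w) :=
    hmem.1.mono_ac (diskHarmonicMeasure_absolutelyContinuous w)
  have hL := orliczInv_nonneg Ψ K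
  have key (M : ℝ) (hM : 0 < M) : ∫ z, min √‖b z‖ M ∂diskHarmonicMeasure w
      ≤ √(2 * orliczInv Ψ K) := by
    set v : ℂ → ℝ := fun z => min √‖b z‖ M with hv
    have hv₀ (z : ℂ) : 0 ≤ v z := le_min (Real.sqrt_nonneg _) hM.le
    have hvi : Integrable v (diskHarmonicMeasure w) := by
      refine Integrable.of_bound ?_ M (Eventually.of_forall fun z => ?_)
      · exact (hb.norm.aemeasurable.sqrt.min aemeasurable_const).aestronglyMeasurable
      · rw [Real.norm_of_nonneg (hv₀ z)]
        exact min_le_right _ _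
    have hΦm : AEMeasurable (fun z => Ψ (v z ^ 2 / 2)) (diskHarmonicMeasure w) :=
      hΨ.aemeasurable_comp ((hvi.aemeasurable.pow_const 2).div_const 2) fun z => by positivity
    have hΦ₀ (z : ℂ) : 0 ≤ Ψ (v z ^ 2 / 2) := hΨ.nonneg (by positivity)
    have hΦi : Integrable (fun z => Ψ (v z ^ 2 / 2)) (diskHarmonicMeasure w) := by
      refine Integrable.of_bound hΦm.aestronglyMeasurable (Ψ (M ^ 2 / 2))
        (Eventually.of_forall fun z => ?_)
      rw [Real.norm_of_nonneg (hΦ₀ z)]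
      refine hΨ.mono (by positivity) ?_
      have := hv₀ z
      have : v z ≤ M := min_le_right _ _
      gcongr
    have hjensen := hΨ.convexOn_comp_sq_div_two.map_integral_le
      (hΨ.continuousOn.comp (by fun_prop) fun x _ => by simp; positivity) isClosed_Ici
      (Eventually.of_forall hv₀) hvi hΦi
    have hint : ∫ z, Ψ (v z ^ 2 / 2) ∂diskHarmonicMeasure w ≤ K := by
      rw [integral_eq_lintegral_of_nonneg_ae (Eventually.of_forall hΦ₀) hΦm.aestronglyMeasurable]
      refine ENNReal.toReal_le_of_le_ofReal hK ?_
      calc ∫⁻ z, ENNReal.ofReal (Ψ (v z ^ 2 / 2)) ∂diskHarmonicMeasure w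
          ≤ ∫⁻ z, ENNReal.ofReal (Ψ (‖b z‖ / 2)) ∂diskHarmonicMeasure w := by
            refine lintegral_mono fun z => ENNReal.ofReal_le_ofReal (hΨ.mono (by positivity) ?_)
            have h1 : v z ≤ √‖b z‖ := min_le_left _ _
            have h2 := Real.sq_sqrt (norm_nonneg (b z))
            have := pow_le_pow_left₀ (hv₀ z) h1 2
            linarith
        _ ≤ ENNReal.ofReal K * 1 := (lintegral_diskHarmonicMeasure_le hw _).trans
            (by gcongr; exact hmod)
        _ = ENNReal.ofReal K := mul_one _
    have := (hΨ.le_orliczInv_iff (by positivity) hK).2 (hjensen.trans hint)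
    exact Real.le_sqrt_of_sq_le (by linarith)
  -- The Jensen bound does not depend on M, and the truncation error K B / M vanishes as M → ∞.
  have hlimM : Tendsto (fun M : ℝ => √(2 * orliczInv Ψ K) + K * B / M) atTop
      (𝓝 √(2 * orliczInv Ψ K)) := by
    simpa using (tendsto_const_nhds (x := √(2 * orliczInv Ψ K))).add
      ((tendsto_const_nhds (x := K * B)).div_atTop tendsto_id)
  have hfin : √‖f w‖ ≤ √(2 * orliczInv Ψ K) := by
    refine ge_of_tendsto hlimM ((eventually_gt_atTop 0).mono fun M hM => ?_)
    exact (sqrt_norm_le_integral_min_add hd hB hlim hw hM).trans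
      (add_le_add_left (key M hM) _)
  exact (Real.sqrt_le_sqrt_iff (by positivity)).1 hfin

end IsOrliczFunction

/-! ### Test functions in the unit ball -/

/-- The extremal functions of Hardy-Orlicz spaces, up to constants. -/
noncomputable def hardyTestFunction (Ψ : ℝ → ℝ) (w z : ℂ) : ℂ :=
  (orliczInv Ψ (1 - ‖w‖)⁻¹ : ℂ) * ((1 - ‖w‖ : ℝ) / (1 - (starRingEnd ℂ) w * z)) ^ 2

section TestFunction

variable {Ψ : ℝ → ℝ} {w z : ℂ}

lemma one_sub_norm_le_norm_one_sub (hz : ‖z‖ ≤ 1) :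
    1 - ‖w‖ ≤ ‖1 - (starRingEnd ℂ) w * z‖ := by
  have h := norm_sub_norm_le (1 : ℂ) ((starRingEnd ℂ) w * z)
  rw [norm_mul, Complex.norm_conj, norm_one] at h
  nlinarith [norm_nonneg w]

lemma norm_hardyTestFunction (hw : ‖w‖ < 1) :
    ‖hardyTestFunction Ψ w z‖
      = ((1 - ‖w‖) / ‖1 - (starRingEnd ℂ) w * z‖) ^ 2 * orliczInv Ψ (1 - ‖w‖)⁻¹ := by
  rw [hardyTestFunction, norm_mul, norm_pow, norm_div,
    Complex.norm_of_nonneg (IsOrliczFunction.orliczInv_nonneg _ _),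
    Complex.norm_of_nonneg (by linarith), mul_comm]

lemma differentiableAt_hardyTestFunction (hw : ‖w‖ < 1) (hz : ‖z‖ ≤ 1) :
    DifferentiableAt ℂ (hardyTestFunction Ψ w) z := by
  have h := one_sub_norm_le_norm_one_sub (w := w) hz
  have hne : 1 - (starRingEnd ℂ) w * z ≠ 0 := by
    rw [← norm_pos_iff]
    linarith
  unfold hardyTestFunction
  fun_prop (disch := exact hne)

lemma boundaryFunction_hardyTestFunction (hw : ‖w‖ < 1) (hz : ‖z‖ = 1) :
    Tendsto (fun r : ℝ => hardyTestFunction Ψ w (r * z)) (𝓝[<] 1)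
      (𝓝 (hardyTestFunction Ψ w z)) := by
  have h1 : Tendsto (fun r : ℝ => (r : ℂ) * z) (𝓝[<] 1) (𝓝 z) := by
    have : Continuous fun r : ℝ => (r : ℂ) * z := by fun_prop
    simpa using (this.tendsto 1).mono_left nhdsWithin_le_nhds
  exact (differentiableAt_hardyTestFunction hw hz.le).continuousAt.tendsto.comp h1

lemma boundaryFunction_hardyTestFunction_ae_eq (hw : ‖w‖ < 1) :
    boundaryFunction (hardyTestFunction Ψ w) =ᵐ[circleMeasure] hardyTestFunction Ψ w := by
  filter_upwards [ae_circleMeasure_mem_sphere] with z hz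
  exact (boundaryFunction_hardyTestFunction hw (mem_sphere_zero_iff_norm.1 hz)).limUnder_eq

/-- On the circle |1 - w̄z| = |z - w|. Since Ψ(kx) ≤ kΨ(x) for k = ((1 - |w|)/|z - w|)² ≤ 1, the
left side is at most (1 - |w|)/|z - w|². The modular bound follows because the Poisson kernel has
integral 1. -/
lemma IsOrliczFunction.map_norm_hardyTestFunction_le (hΨ : IsOrliczFunction Ψ) (hw : ‖w‖ < 1)
    (hz : ‖z‖ = 1) : Ψ ‖hardyTestFunction Ψ w z‖ ≤ poissonKernel 0 w z := by
  have h := one_sub_norm_le_norm_one_sub (w := w) hz.le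
  have hpos : 0 < 1 - ‖w‖ := by linarith
  have hD : ‖1 - (starRingEnd ℂ) w * z‖ = ‖z - w‖ := by
    have h1 : 1 - (starRingEnd ℂ) w * z = z * (starRingEnd ℂ) (z - w) := by
      rw [map_sub, mul_sub, Complex.mul_conj, Complex.normSq_eq_norm_sq, hz]
      simp [mul_comm]
    rw [h1, norm_mul, hz, one_mul, Complex.norm_conj]
  have hDpos : 0 < ‖z - w‖ := by linarith
  rw [norm_hardyTestFunction hw, poissonKernel_def, sub_zero, sub_zero, hz, hD]
  rw [hD] at h
  have hk : (1 - ‖w‖) / ‖z - w‖ ≤ 1 := (div_le_one hDpos).2 h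
  refine (hΨ.map_mul_le (sq_nonneg _) (pow_le_one₀ (by positivity) hk)
    (IsOrliczFunction.orliczInv_nonneg _ _)).trans ?_
  calc ((1 - ‖w‖) / ‖z - w‖) ^ 2 * Ψ (orliczInv Ψ (1 - ‖w‖)⁻¹)
      ≤ ((1 - ‖w‖) / ‖z - w‖) ^ 2 * (1 - ‖w‖)⁻¹ := by
        gcongr
        exact hΨ.map_orliczInv_le (by positivity)
    _ = (1 - ‖w‖) / ‖z - w‖ ^ 2 := by field_simp
    _ ≤ (1 ^ 2 - ‖w‖ ^ 2) / ‖z - w‖ ^ 2 := by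
        refine div_le_div_of_nonneg_right ?_ (sq_nonneg _)
        nlinarith [mul_nonneg (norm_nonneg w) hpos.le]

lemma IsOrliczFunction.orliczModular_hardyTestFunction_le (hΨ : IsOrliczFunction Ψ)
    (hw : ‖w‖ < 1) :
    orliczModular Ψ circleMeasure (boundaryFunction (hardyTestFunction Ψ w)) 1 ≤ 1 := by
  rw [← lintegral_poissonKernel (mem_ball_zero_iff.2 hw)]
  refine lintegral_mono_ae ?_
  filter_upwards [ae_circleMeasure_mem_sphere, boundaryFunction_hardyTestFunction_ae_eq hw]
    with z hz hzb
  rw [hzb, div_one]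
  exact ENNReal.ofReal_le_ofReal
    (hΨ.map_norm_hardyTestFunction_le hw (mem_sphere_zero_iff_norm.1 hz))

lemma IsOrliczFunction.hardyTestFunction_mem (hΨ : IsOrliczFunction Ψ) (hw : ‖w‖ < 1) :
    hardyTestFunction Ψ w ∈ hardyOrlicz Ψ := by
  have hcont : ContinuousOn (hardyTestFunction Ψ w) (Metric.closedBall 0 1) := fun z hz =>
    (differentiableAt_hardyTestFunction hw
      (mem_closedBall_zero_iff.1 hz)).continuousAt.continuousWithinAt
  refine ⟨⟨fun z hz => (differentiableAt_hardyTestFunction hw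
    (mem_ball_zero_iff.1 hz).le).differentiableWithinAt, orliczInv Ψ (1 - ‖w‖)⁻¹, ?_⟩, ?_, ?_,
    1, one_pos, (hΨ.orliczModular_hardyTestFunction_le hw).trans_lt ENNReal.one_lt_top⟩
  · intro r hr
    have hsub : Metric.sphere (0 : ℂ) |r| ⊆ Metric.closedBall 0 1 := fun z hz => by
      rw [mem_sphere_zero_iff_norm, abs_of_pos hr.1] at hz
      rw [mem_closedBall_zero_iff, hz]
      exact hr.2.le
    refine Real.circleAverage_mono_on_of_le_circle
      (ContinuousOn.circleIntegrable' (hcont.mono hsub).norm) fun z hz => ?_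
    have h := one_sub_norm_le_norm_one_sub (w := w) (mem_closedBall_zero_iff.1 (hsub hz))
    have hpos : 0 < 1 - ‖w‖ := by linarith
    rw [norm_hardyTestFunction hw]
    refine mul_le_of_le_one_left (IsOrliczFunction.orliczInv_nonneg _ _) ?_
    exact pow_le_one₀ (by positivity) ((div_le_one (by linarith)).2 h)
  · filter_upwards [ae_circleMeasure_mem_sphere] with z hz
    exact ⟨_, boundaryFunction_hardyTestFunction hw (mem_sphere_zero_iff_norm.1 hz)⟩
  · have h := (hcont.mono Metric.sphere_subset_closedBall).aestronglyMeasurable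
      (μ := circleMeasure) Metric.isClosed_sphere.measurableSet
    rw [Measure.restrict_eq_self_of_ae_mem ae_circleMeasure_mem_sphere] at h
    exact h.congr (boundaryFunction_hardyTestFunction_ae_eq hw).symm

end TestFunction

/-! ### Order bounds and the weak Orlicz space -/

namespace IsOrliczFunction

variable {Ψ : ℝ → ℝ}

/-- Functions dominating the unit ball of a Hardy-Orlicz space grow at least like the extremal
functions. -/
lemma ae_orliczInv_le_of_isOrderBound (hΨ : IsOrliczFunction Ψ) {y : ℂ → ℝ}
    (hy : ∀ f : hardyOrlicz Ψ, hardyOrliczNorm Ψ f ≤ 1 →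
      ∀ᵐ s ∂diskMeasure, ‖canonicalInjection Ψ f s‖ ≤ y s) :
    ∀ᵐ s ∂diskMeasure, orliczInv Ψ (2 * (1 - ‖s‖))⁻¹ ≤ 16 * y s := by
  -- The exceptional null set depends on the test function, so w is confined to a countable dense
  -- set and then taken close to s.
  obtain ⟨D, hDc, hDd⟩ := TopologicalSpace.exists_countable_dense ℂ
  have hD : ∀ᵐ s ∂diskMeasure, ∀ w ∈ D, ‖w‖ < 1 → ‖hardyTestFunction Ψ w s‖ ≤ y s := by
    refine (ae_ball_iff hDc).2 fun w _ => ?_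
    by_cases hw : ‖w‖ < 1
    · have hmem := hΨ.hardyTestFunction_mem hw
      filter_upwards [hy ⟨_, hmem⟩ (luxemburgNorm_le Ψ _ _ one_pos
        (hΨ.orliczModular_hardyTestFunction_le hw)), AEEqFun.coeFn_mk _
        (hardyOrlicz_aestronglyMeasurable ⟨_, hmem⟩)] with s hs hs' _
      rwa [canonicalInjection, hs'] at hs
    · exact Eventually.of_forall fun s h => absurd h hw
  filter_upwards [hD, ae_diskMeasure_mem_ball] with s hs hsb
  have hs₁ : ‖s‖ < 1 := mem_ball_zero_iff.1 hsb
  -- These strict conditions hold at w = s, as 1 - |s|² ≤ 2(1 - |s|). They make the test function at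
  -- s at least (1/4)² Ψ⁻¹(1/(1 - |w|)), whence the factor 16.
  have hU : IsOpen {w : ℂ | ‖w‖ < 1 ∧ 1 - ‖w‖ < 2 * (1 - ‖s‖) ∧
      ‖1 - (starRingEnd ℂ) w * s‖ < 4 * (1 - ‖w‖)} := by
    have hconj := Complex.continuous_conj
    have h₁ : IsOpen {w : ℂ | ‖w‖ < 1} := isOpen_lt (by fun_prop) (by fun_prop)
    have h₂ : IsOpen {w : ℂ | 1 - ‖w‖ < 2 * (1 - ‖s‖)} := isOpen_lt (by fun_prop) (by fun_prop)
    have h₃ : IsOpen {w : ℂ | ‖1 - (starRingEnd ℂ) w * s‖ < 4 * (1 - ‖w‖)} :=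
      isOpen_lt (by fun_prop) (by fun_prop)
    exact h₁.inter (h₂.inter h₃)
  obtain ⟨w, ⟨hw₁, hw₂, hw₃⟩, hwD⟩ := hDd.inter_open_nonempty _ hU ⟨s, hs₁, by linarith, by
    rw [mul_comm, Complex.mul_conj, Complex.normSq_eq_norm_sq, ← Complex.ofReal_one,
      ← Complex.ofReal_sub, Complex.norm_of_nonneg (by nlinarith [norm_nonneg s])]
    nlinarith [norm_nonneg s]⟩
  have h := hs w hwD hw₁
  rw [norm_hardyTestFunction hw₁] at h
  have hpos : 0 < 1 - ‖w‖ := by linarith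
  have hDpos := hpos.trans_le (one_sub_norm_le_norm_one_sub (w := w) hs₁.le)
  have hk : (1 : ℝ) / 4 ≤ (1 - ‖w‖) / ‖1 - (starRingEnd ℂ) w * s‖ := by
    rw [div_le_div_iff₀ (by norm_num) hDpos]
    linarith
  have hk2 := pow_le_pow_left₀ (by norm_num) hk 2
  have hmono : orliczInv Ψ (2 * (1 - ‖s‖))⁻¹ ≤ orliczInv Ψ (1 - ‖w‖)⁻¹ := by
    refine hΨ.monotone_orliczInv ?_
    gcongr
  have := mul_le_mul_of_nonneg_right hk2 (orliczInv_nonneg Ψ (1 - ‖w‖)⁻¹)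
  linarith

/-- The set is the annulus 1 - |s| ≤ 1/(2Ψ(t)), whose area is at least its width; when 2Ψ(t) ≤ 1 it
fills the disk. -/
lemma le_diskMeasure_le_orliczInv (hΨ : IsOrliczFunction Ψ) {t : ℝ} (ht : 0 ≤ t) :
    min 1 (ENNReal.ofReal (2 * Ψ t))⁻¹
      ≤ diskMeasure {s | t ≤ orliczInv Ψ (2 * (1 - ‖s‖))⁻¹} := by
  have h0 := hΨ.nonneg ht
  have hset {s : ℂ} (hs : ‖s‖ < 1) (h : 2 * Ψ t * (1 - ‖s‖) ≤ 1) :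
      t ≤ orliczInv Ψ (2 * (1 - ‖s‖))⁻¹ := by
    have hs : 0 < 1 - ‖s‖ := by linarith
    rw [hΨ.le_orliczInv_iff ht (by positivity), ← one_div, le_div_iff₀ (by positivity)]
    linarith
  rcases le_or_gt (2 * Ψ t) 1 with h | h
  · refine (min_le_left _ _).trans ?_
    rw [← measure_univ (μ := diskMeasure)]
    refine measure_mono_ae ?_
    filter_upwards [ae_diskMeasure_mem_ball] with s hs _
    have hs₁ := mem_ball_zero_iff.1 hs
    exact hset hs₁ (by nlinarith [norm_nonneg s])
  · refine (min_le_right _ _).trans ?_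
    rw [← ENNReal.ofReal_inv_of_pos (by linarith)]
    refine (le_diskMeasure_lt_norm (by positivity) (inv_le_one_of_one_le₀ h.le)).trans ?_
    refine measure_mono_ae ?_
    filter_upwards [ae_diskMeasure_mem_ball] with s hs hs'
    refine hset (mem_ball_zero_iff.1 hs) ?_
    have hs' : 1 - (2 * Ψ t)⁻¹ < ‖s‖ := hs'
    have : 1 - ‖s‖ ≤ (2 * Ψ t)⁻¹ := by linarith
    calc 2 * Ψ t * (1 - ‖s‖) ≤ 2 * Ψ t * (2 * Ψ t)⁻¹ := by gcongr
      _ = 1 := mul_inv_cancel₀ (by linarith)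

lemma weakOrliczSpace_subset_of_isOrderBoundedInto (hΨ : IsOrliczFunction Ψ)
    (h : IsOrderBoundedInto (hardyOrliczNorm Ψ) (canonicalInjection Ψ)
      (orliczSpace Ψ diskMeasure)) :
    weakOrliczSpace Ψ diskMeasure ⊆ orliczSpace Ψ diskMeasure := by
  obtain ⟨y, ⟨hym, C, hC, hfin⟩, -, hy⟩ := h
  have hlow := hΨ.ae_orliczInv_le_of_isOrderBound hy
  rintro g ⟨c, hc, hg⟩
  refine ⟨g.aestronglyMeasurable, C / (c / 64), by positivity,
    (hΨ.orliczModular_le_of_meas_le g.aestronglyMeasurable hym (by positivity)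
      (fun t ht => ?_) hC).trans_lt hfin⟩
  -- Convexity absorbs the factor 2 from the annulus estimate.
  have hdouble : 2 * Ψ (c * t / 2) ≤ Ψ (c * t) := by
    have := hΨ.map_mul_le (t := 1 / 2) (x := c * t) (by norm_num) (by norm_num) (by positivity)
    rw [show c * t / 2 = 1 / 2 * (c * t) by ring]
    linarith
  calc diskMeasure {s | t < ‖g s‖} ≤ min 1 (ENNReal.ofReal (2 * Ψ (c * t / 2)))⁻¹ :=
        le_min prob_le_one ((hg t ht).trans (by gcongr))
    _ ≤ diskMeasure {s | c * t / 2 ≤ orliczInv Ψ (2 * (1 - ‖s‖))⁻¹} :=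
        hΨ.le_diskMeasure_le_orliczInv (by positivity)
    -- From ct/2 ≤ 16 y one gets y ≥ ct/32; the constant c/64 leaves room for strict inequality.
    _ ≤ diskMeasure {s | c / 64 * t < ‖y s‖} := by
        refine measure_mono_ae ?_
        filter_upwards [hlow] with s hs hs'
        have hs' : c * t / 2 ≤ orliczInv Ψ (2 * (1 - ‖s‖))⁻¹ := hs'
        have h1 : (y s).re ≤ ‖y s‖ := Complex.re_le_norm _
        have h2 : 0 < c * t := by positivity
        change c / 64 * t < ‖y s‖
        linarith

lemma isOrderBoundedInto_of_weakOrliczSpace_subset (hΨ : IsOrliczFunction Ψ)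
    (h : weakOrliczSpace Ψ diskMeasure ⊆ orliczSpace Ψ diskMeasure) :
    IsOrderBoundedInto (hardyOrliczNorm Ψ) (canonicalInjection Ψ) (orliczSpace Ψ diskMeasure) := by
  set Y : ℂ → ℝ := fun z => 2 * orliczInv Ψ ((1 + ‖z‖) / (1 - ‖z‖)) with hY
  have hY₀ (z : ℂ) : 0 ≤ Y z := mul_nonneg two_pos.le (orliczInv_nonneg _ _)
  have hYm : Measurable Y :=
    (hΨ.monotone_orliczInv.measurable.comp (by fun_prop)).const_mul 2
  have hYs : AEStronglyMeasurable (fun z => (Y z : ℂ)) diskMeasure :=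
    (Complex.measurable_ofReal.comp hYm).aestronglyMeasurable
  have hmk := AEEqFun.coeFn_mk _ hYs
  refine ⟨AEEqFun.mk _ hYs, h ⟨1 / 16, by norm_num, fun t ht => ?_⟩, ?_, fun f hf => ?_⟩
  -- The bound exceeds t only in an annulus of width 4/Ψ(t/2), hence of area at most 8/Ψ(t/2); the 8
  -- is absorbed by convexity.
  · have h8 : 8 * Ψ (1 / 16 * t) ≤ Ψ (t / 2) := by
      have := hΨ.map_mul_le (t := 1 / 8) (x := t / 2) (by norm_num) (by norm_num) (by positivity)
      rw [show 1 / 16 * t = 1 / 8 * (t / 2) by ring]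
      linarith
    rcases (hΨ.nonneg (x := 1 / 16 * t) (by positivity)).eq_or_lt with h0 | h0
    · rw [← h0]
      simp
    · have hpos : 0 < Ψ (t / 2) := by linarith
      calc diskMeasure {s | t < ‖AEEqFun.mk _ hYs s‖}
          ≤ diskMeasure {s | 1 - 4 / Ψ (t / 2) < ‖s‖} := by
            refine measure_mono_ae ?_
            filter_upwards [hmk, ae_diskMeasure_mem_ball] with s hs hsb hs'
            have hs' : t < ‖AEEqFun.mk _ hYs s‖ := hs'
            have hs₁ : 0 < 1 - ‖s‖ := by
              have := mem_ball_zero_iff.1 hsb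
              linarith
            rw [hs, Complex.norm_of_nonneg (hY₀ s)] at hs'
            have h1 : t / 2 ≤ orliczInv Ψ ((1 + ‖s‖) / (1 - ‖s‖)) := by
              simp only [hY] at hs'
              linarith
            rw [hΨ.le_orliczInv_iff (by positivity) (by positivity), le_div_iff₀ hs₁] at h1
            change 1 - 4 / Ψ (t / 2) < ‖s‖
            have : 1 - ‖s‖ < 4 / Ψ (t / 2) := by
              rw [lt_div_iff₀ hpos]
              linarith
            linarith
        _ ≤ ENNReal.ofReal (2 * (4 / Ψ (t / 2))) := diskMeasure_lt_norm_le (by positivity)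
        _ ≤ (ENNReal.ofReal (Ψ (1 / 16 * t)))⁻¹ := by
            rw [← ENNReal.ofReal_inv_of_pos h0]
            refine ENNReal.ofReal_le_ofReal ?_
            rw [← one_div, ← mul_div_assoc, div_le_div_iff₀ hpos h0]
            linarith
  · filter_upwards [hmk] with s hs
    rw [hs]
    exact ⟨hY₀ s, Complex.ofReal_im _⟩
  · filter_upwards [hmk, AEEqFun.coeFn_mk _ (hardyOrlicz_aestronglyMeasurable f),
      ae_diskMeasure_mem_ball] with s hs hfs hsb
    rw [canonicalInjection, hfs, hs, Complex.ofReal_re]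
    exact hΨ.norm_le_orliczInv f hf hsb

/-! ### The growth condition Δ¹ -/

/-- Under the growth condition `Δ¹`, the weak Orlicz space of a finite measure is contained in the
Orlicz space. -/
lemma weakOrliczSpace_subset_of_deltaOne (hΨ : IsOrliczFunction Ψ) (hΔ : DeltaOne Ψ) {S : Type*}
    [MeasurableSpace S] (μ : Measure S) [IsFiniteMeasure μ] :
    weakOrliczSpace Ψ μ ⊆ orliczSpace Ψ μ := by
  obtain ⟨α, hα, hev⟩ := hΔ
  obtain ⟨x₀, hx₀⟩ := hev.exists_forall_of_atTop
  rintro g ⟨c, hc, hg⟩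
  have hα₀ : 0 < α := one_pos.trans hα
  set T := max 1 x₀ with hT
  have hT₁ : 1 ≤ T := le_max_left _ _
  -- Chosen so that the weak bound for `E k` is exactly 1/Ψ(αu) with u = T 2^(k+1); halving the
  -- threshold in `E k` makes its inequality strict.
  set β := 4 * α / c with hβ
  have hβ₀ : 0 < β := by positivity
  refine ⟨g.aestronglyMeasurable, β, hβ₀, ?_⟩
  let E : ℕ → Set S := fun k => {s | β * (T * 2 ^ k) / 2 < ‖g s‖}
  have hE (k : ℕ) : MeasurableSet (E k) := measurableSet_lt measurable_const g.measurable.norm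
  have hpt (s : S) : ENNReal.ofReal (Ψ (‖g s‖ / β)) ≤ ENNReal.ofReal (Ψ T) +
      ∑' k, (E k).indicator (fun _ => ENNReal.ofReal (Ψ (T * 2 ^ (k + 1)))) s := by
    rcases le_total (‖g s‖ / β) T with hle | hle
    · exact (ENNReal.ofReal_le_ofReal (hΨ.mono (by positivity) hle)).trans le_self_add
    · obtain ⟨k, hk₁, hk₂⟩ := exists_nat_pow_near (x := ‖g s‖ / β / T) (y := (2 : ℝ))
        ((one_le_div (by positivity)).2 hle) one_lt_two
      rw [le_div_iff₀ (by positivity), le_div_iff₀ hβ₀] at hk₁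
      rw [div_lt_iff₀ (by positivity)] at hk₂
      have hmem : s ∈ E k := by
        have : 0 < β * (T * 2 ^ k) := by positivity
        change β * (T * 2 ^ k) / 2 < ‖g s‖
        linarith
      refine le_trans ?_ (le_add_self.trans (add_le_add_right (ENNReal.le_tsum k) _))
      rw [indicator_of_mem hmem]
      exact ENNReal.ofReal_le_ofReal (hΨ.mono (by positivity) (by linarith))
  -- By Δ¹ and the weak bound, the term is at most Ψ(u)/Ψ(αu) ≤ 1/u ≤ 2^(-k) when Ψ(u) > 0, and is 0
  -- otherwise.
  have hterm (k : ℕ) : ENNReal.ofReal (Ψ (T * 2 ^ (k + 1))) * μ (E k) ≤ 2⁻¹ ^ k := by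
    set u := T * 2 ^ (k + 1) with hu
    have hu₀ : 0 < u := by positivity
    have hku : (2 : ℝ) ^ k ≤ u := by
      rw [hu, pow_succ]
      have : (0 : ℝ) < 2 ^ k := by positivity
      nlinarith
    have hTu : T ≤ u := le_mul_of_one_le_right (by positivity) (one_le_pow₀ one_le_two)
    have hΔu := hx₀ u ((le_max_right _ _).trans hTu)
    have hΨu := hΨ.nonneg hu₀.le
    have hμ := hg (β * (T * 2 ^ k) / 2) (by positivity)
    have harg : c * (β * (T * 2 ^ k) / 2) = α * u := by
      rw [hβ, hu, pow_succ]
      field_simp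
      ring
    rw [harg] at hμ
    rcases hΨu.eq_or_lt with h0 | h0
    · simp [← h0]
    · refine (mul_le_mul_right hμ _).trans ?_
      have hpos : 0 < Ψ (α * u) := lt_of_lt_of_le (by positivity) hΔu
      have h2 : (2⁻¹ : ENNReal) ^ k = ENNReal.ofReal ((2 ^ k)⁻¹) := by
        rw [ENNReal.ofReal_inv_of_pos (by positivity), ENNReal.ofReal_pow two_pos.le,
          ENNReal.ofReal_ofNat, ENNReal.inv_pow]
      rw [h2, ← ENNReal.ofReal_inv_of_pos hpos, ← ENNReal.ofReal_mul hΨu]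
      refine ENNReal.ofReal_le_ofReal ?_
      rw [← div_eq_mul_inv, div_le_iff₀ hpos, inv_mul_eq_div, le_div_iff₀ (by positivity)]
      nlinarith
  calc orliczModular Ψ μ g β
      ≤ ∫⁻ s, (ENNReal.ofReal (Ψ T) +
        ∑' k, (E k).indicator (fun _ => ENNReal.ofReal (Ψ (T * 2 ^ (k + 1)))) s) ∂μ :=
        lintegral_mono hpt
    _ = ENNReal.ofReal (Ψ T) * μ univ + ∑' k, ENNReal.ofReal (Ψ (T * 2 ^ (k + 1))) * μ (E k) := by
        rw [lintegral_add_left measurable_const, lintegral_const,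
          lintegral_tsum fun k => (measurable_const.indicator (hE k)).aemeasurable]
        congr 1
        exact tsum_congr fun k => lintegral_indicator_const (hE k) _
    _ ≤ ENNReal.ofReal (Ψ T) * μ univ + ∑' k : ℕ, 2⁻¹ ^ k := by
        gcongr with k
        exact hterm k
    _ < ⊤ := by
        refine ENNReal.add_lt_top.2 ⟨ENNReal.mul_lt_top ENNReal.ofReal_lt_top
          (measure_lt_top _ _), ?_⟩
        rw [ENNReal.tsum_geometric, ENNReal.one_sub_inv_two, inv_inv]
        exact ENNReal.ofNat_lt_top

end IsOrliczFunction

theorem mainTheorem10 (Ψ : ℝ → ℝ) (hΨ : IsOrliczFunction Ψ) :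
    (IsOrderBoundedInto (hardyOrliczNorm Ψ) (canonicalInjection Ψ) (orliczSpace Ψ diskMeasure) ↔
      orliczSpace Ψ diskMeasure = weakOrliczSpace Ψ diskMeasure) ∧
    (DeltaOne Ψ →
      orliczSpace Ψ diskMeasure = weakOrliczSpace Ψ diskMeasure ∧
      IsOrderBoundedInto (hardyOrliczNorm Ψ) (canonicalInjection Ψ)
        (orliczSpace Ψ diskMeasure)) := by
  refine ⟨⟨fun h => ?_, fun h => ?_⟩, fun hΔ => ?_⟩
  · exact hΨ.orliczSpace_subset_weakOrliczSpace.antisymm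
      (hΨ.weakOrliczSpace_subset_of_isOrderBoundedInto h)
  · exact hΨ.isOrderBoundedInto_of_weakOrliczSpace_subset h.superset
  · have h := hΨ.weakOrliczSpace_subset_of_deltaOne hΔ diskMeasure
    exact ⟨hΨ.orliczSpace_subset_weakOrliczSpace.antisymm h,
      hΨ.isOrderBoundedInto_of_weakOrliczSpace_subset h⟩
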